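/- Let $A_2=\mathbb C\langle x,y,\partial_x,\partial_y\rangle$ be the second Weyl algebra over $\mathbb C$, let $\beta=(\beta_1,\beta_2,\beta_3)\in\mathbb C^3$, and put $\alpha_1=x$, $\alpha_2=y$, $\alpha_3=x+y+1$, $\alpha=\alpha_1\alpha_2\alpha_3$. Let $$M_\alpha^\beta=\mathbb C[x,y]_{\alpha}\,x^{\beta_1}y^{\beta_2}(x+y+1)^{\beta_3}$$ be the free $\mathbb C[x,y]_\alpha$-module of rank one on the symbol $\alpha^\beta=x^{\beta_1}y^{\beta_2}(x+y+1)^{\beta_3}$, made into a left $A_2$-module by letting $x,y$ act by multiplication and, for $\partial\in\{\partial_x,\partial_y\}$ and $f\in\mathbb C[x,y]_\alpha$, $$\partial\,(f\alpha^\beta)=\Bigl(\partial(f)+f\sum_{i=1}^{3}\beta_i\frac{\partial(\alpha_i)}{\alpha_i}\Bigr)\alpha^\beta .$$ Let $c(M_\alpha^\beta)$ be the number of decomposition factors of $M_\alpha^\beta$, that is, the length of a composition series of $M_\alpha^\beta$ as an $A_2$-module. Then $M_\alpha^\beta$ has finite length, and: (i) if none of $\beta_1,\beta_2,\beta_3$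 is an integer, then $c(M_\alpha^\beta)=1$, and hence $M_\alpha^\beta$ is irreducible; (ii) if exactly one of $\beta_1,\beta_2,\beta_3$ is an integer, then $c(M_\alpha^\beta)=2$; (iii) if exactly two of $\beta_1,\beta_2,\beta_3$ are integers, then $c(M_\alpha^\beta)=4$; (iv) if $\beta_1,\beta_2,\beta_3$ are all integers, then $c(M_\alpha^\beta)=7$. -/

import Mathlib

noncomputable section

open MvPolynomial

/-! ### The Weyl algebra -/

/-- The defining relations of the `n`-th Weyl algebra, in the free algebra on the letters
`x_i = ι (Sum.inl i)` and `∂_i = ι (Sum.inr i)`. -/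
inductive WeylRel (n : ℕ) :
    FreeAlgebra ℂ (Fin n ⊕ Fin n) → FreeAlgebra ℂ (Fin n ⊕ Fin n) → Prop
  | x_comm (i j : Fin n) : WeylRel n
      (FreeAlgebra.ι ℂ (Sum.inl i) * FreeAlgebra.ι ℂ (Sum.inl j))
      (FreeAlgebra.ι ℂ (Sum.inl j) * FreeAlgebra.ι ℂ (Sum.inl i))
  | d_comm (i j : Fin n) : WeylRel n
      (FreeAlgebra.ι ℂ (Sum.inr i) * FreeAlgebra.ι ℂ (Sum.inr j))
      (FreeAlgebra.ι ℂ (Sum.inr j) * FreeAlgebra.ι ℂ (Sum.inr i))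
  | d_x (i j : Fin n) : WeylRel n
      (FreeAlgebra.ι ℂ (Sum.inr i) * FreeAlgebra.ι ℂ (Sum.inl j))
      (FreeAlgebra.ι ℂ (Sum.inl j) * FreeAlgebra.ι ℂ (Sum.inr i) + if i = j then 1 else 0)

/-- The `n`-th Weyl algebra `A_n` over `ℂ`. -/
abbrev WeylAlgebra (n : ℕ) : Type := RingQuot (WeylRel n)

/-- The generator `x_i` of the Weyl algebra. -/
def WeylAlgebra.x {n : ℕ} (i : Fin n) : WeylAlgebra n :=
  RingQuot.mkAlgHom ℂ (WeylRel n) (FreeAlgebra.ι ℂ (Sum.inl i))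

/-- The generator `∂_i` of the Weyl algebra. -/
def WeylAlgebra.d {n : ℕ} (i : Fin n) : WeylAlgebra n :=
  RingQuot.mkAlgHom ℂ (WeylRel n) (FreeAlgebra.ι ℂ (Sum.inr i))

/-! ### The partial derivatives on a localization of the polynomial ring -/

section Localization

variable {n : ℕ} (a : MvPolynomial (Fin n) ℂ) (i : Fin n)

/-- The ring homomorphism `p ↦ p + ε ∂_i p` from `ℂ[x]` to the dual numbers over `ℂ[x]_a`. -/
def polyToDual : MvPolynomial (Fin n) ℂ →ₐ[ℂ]
    TrivSqZeroExt (Localization.Away a) (Localization.Away a) where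
  toFun p := TrivSqZeroExt.inl (algebraMap _ _ p) + TrivSqZeroExt.inr (algebraMap _ _ (pderiv i p))
  map_one' := by ext <;> simp
  map_zero' := by ext <;> simp
  map_add' p q := by
    ext
    · simp
    · simp only [map_add, TrivSqZeroExt.snd_add, TrivSqZeroExt.snd_inl, TrivSqZeroExt.snd_inr]
      ring
  map_mul' p q := by
    ext
    · simp
    · simp only [map_add, map_mul, Derivation.leibniz, smul_eq_mul, TrivSqZeroExt.snd_add,
        TrivSqZeroExt.snd_inl, TrivSqZeroExt.snd_inr, TrivSqZeroExt.snd_mul,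
        TrivSqZeroExt.fst_add, TrivSqZeroExt.fst_inl, TrivSqZeroExt.fst_inr, add_zero, zero_add,
        op_smul_eq_mul]
      ring
  commutes' r := by
    rw [Derivation.map_algebraMap, map_zero, TrivSqZeroExt.inr_zero, add_zero,
      ← IsScalarTower.algebraMap_apply, TrivSqZeroExt.algebraMap_eq_inl']

lemma fst_polyToDual (p : MvPolynomial (Fin n) ℂ) :
    (polyToDual a i p).fst = algebraMap _ (Localization.Away a) p := by
  change (TrivSqZeroExt.inl (algebraMap _ (Localization.Away a) p) +
    TrivSqZeroExt.inr (algebraMap _ (Localization.Away a) (pderiv i p))).fst = _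
  rw [TrivSqZeroExt.fst_add, TrivSqZeroExt.fst_inl, TrivSqZeroExt.fst_inr, add_zero]

lemma snd_polyToDual (p : MvPolynomial (Fin n) ℂ) :
    (polyToDual a i p).snd = algebraMap _ (Localization.Away a) (pderiv i p) := by
  change (TrivSqZeroExt.inl (algebraMap _ (Localization.Away a) p) +
    TrivSqZeroExt.inr (algebraMap _ (Localization.Away a) (pderiv i p))).snd = _
  rw [TrivSqZeroExt.snd_add, TrivSqZeroExt.snd_inl, TrivSqZeroExt.snd_inr, zero_add]

/-- The extension of `polyToDual` to `ℂ[x]_a`. -/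
def locToDual : Localization.Away a →ₐ[ℂ]
    TrivSqZeroExt (Localization.Away a) (Localization.Away a) :=
  IsLocalization.liftAlgHom (M := Submonoid.powers a) (f := polyToDual a i) (fun s => by
    rw [TrivSqZeroExt.isUnit_iff_isUnit_fst, fst_polyToDual]
    exact IsLocalization.map_units _ s)

lemma locToDual_algebraMap (p : MvPolynomial (Fin n) ℂ) :
    locToDual a i (algebraMap _ _ p) = polyToDual a i p := by
  simp [locToDual]

lemma fst_locToDual (s : Localization.Away a) : (locToDual a i s).fst = s := by
  have h : ((TrivSqZeroExt.fstHom ℂ (Localization.Away a) (Localization.Away a)).comp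
      (locToDual a i)) = AlgHom.id ℂ _ := by
    apply IsLocalization.algHom_ext (Submonoid.powers a)
    ext p
    change (locToDual a i (algebraMap _ (Localization.Away a) (X p))).fst =
      algebraMap _ (Localization.Away a) (X p)
    rw [locToDual_algebraMap, fst_polyToDual]
  exact DFunLike.congr_fun h s

/-- The unique extension of `∂/∂x_i` to a derivation of `ℂ[x]_a`. -/
def locDeriv : Derivation ℂ (Localization.Away a) (Localization.Away a) where
  toLinearMap :=
    (TrivSqZeroExt.sndHom (Localization.Away a) (Localization.Away a)).restrictScalars ℂ ∘ₗ
      (locToDual a i).toLinearMap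
  map_one_eq_zero' := by simp
  leibniz' s t := by simp [fst_locToDual, mul_comm]

/-- `locDeriv` extends the partial derivative of polynomials. -/
lemma locDeriv_algebraMap (p : MvPolynomial (Fin n) ℂ) :
    locDeriv a i (algebraMap _ _ p) = algebraMap _ _ (pderiv i p) := by
  change (locToDual a i _).snd = _
  rw [locToDual_algebraMap, snd_polyToDual]

lemma locDeriv_comm (i j : Fin n) (s : Localization.Away a) :
    locDeriv a i (locDeriv a j s) = locDeriv a j (locDeriv a i s) := by
  have hp (p : MvPolynomial (Fin n) ℂ) :
      ⁅locDeriv a i, locDeriv a j⁆ (algebraMap _ _ p) = 0 := by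
    rw [Derivation.commutator_apply]
    simp only [locDeriv_algebraMap]
    rw [← map_sub, ← Derivation.commutator_apply]
    have : ⁅pderiv (R := ℂ) i, pderiv (R := ℂ) j⁆ = 0 := by
      ext k
      simp [Derivation.commutator_apply, pderiv_X, Pi.single_apply, apply_ite (pderiv (R := ℂ) _)]
    simp [this]
  obtain ⟨⟨p, q⟩, hs⟩ := IsLocalization.surj (Submonoid.powers a) s
  have h := hp p
  rw [← hs, Derivation.leibniz, hp, smul_zero, zero_add, smul_eq_mul,
    (IsLocalization.map_units (Localization.Away a) q).mul_right_eq_zero,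
    Derivation.commutator_apply, sub_eq_zero] at h
  exact h

end Localization

/-! ### The twisted module -/

section Twisted

variable {n m : ℕ} (α : Fin m → MvPolynomial (Fin n) ℂ) (β : Fin m → ℂ)

/-- The coordinate ring `ℂ[x]_α`, where `α = α_1 ⋯ α_m`. -/
abbrev CoordRing : Type := Localization.Away (∏ k, α k)

lemma isUnit_factor (k : Fin m) :
    IsUnit (algebraMap (MvPolynomial (Fin n) ℂ) (CoordRing α) (α k)) :=
  isUnit_of_dvd_unit ((algebraMap _ (CoordRing α)).map_dvd
    (Finset.dvd_prod_of_mem α (Finset.mem_univ k))) (IsLocalization.Away.algebraMap_isUnit _)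

/-- The element `1 / α_k` of `ℂ[x]_α`. -/
def invFactor (k : Fin m) : CoordRing α := ↑((isUnit_factor α k).unit⁻¹)

lemma factor_mul_invFactor (k : Fin m) :
    algebraMap (MvPolynomial (Fin n) ℂ) (CoordRing α) (α k) * invFactor α k = 1 :=
  (isUnit_factor α k).mul_val_inv

/-- The logarithmic derivative `∑_k β_k ∂_j(α_k) / α_k` of `α^β`. -/
def twistLog (j : Fin n) : CoordRing α :=
  ∑ k, β k • (algebraMap _ (CoordRing α) (pderiv j (α k)) * invFactor α k)

/-- The action of `∂_j` on `f α^β`, in terms of the coefficient: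
`f ↦ ∂_j f + f ∑_k β_k ∂_j(α_k) / α_k`. -/
def twistedDeriv (j : Fin n) : Module.End ℂ (CoordRing α) :=
  (locDeriv (∏ k, α k) j).toLinearMap + LinearMap.mulLeft ℂ (twistLog α β j)

/-- The action of `x_j` on `f α^β`, in terms of the coefficient. -/
def coordMul (j : Fin n) : Module.End ℂ (CoordRing α) :=
  LinearMap.mulLeft ℂ (algebraMap (MvPolynomial (Fin n) ℂ) (CoordRing α) (X j))

lemma derivation_logarithmic_comm {S : Type*} [CommRing S] [Algebra ℂ S] (D E : Derivation ℂ S S)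
    {a b : S} (hDE : D (E a) = E (D a)) (hab : a * b = 1) : D (E a * b) = E (D a * b) := by
  have hba : b * a = 1 := (mul_comm b a).trans hab
  rw [Derivation.leibniz, Derivation.leibniz, D.leibniz_of_mul_eq_one hba,
    E.leibniz_of_mul_eq_one hba, hDE]
  simp only [smul_eq_mul]
  ring

lemma locDeriv_twistLog (i j : Fin n) :
    locDeriv (∏ k, α k) i (twistLog α β j) = locDeriv (∏ k, α k) j (twistLog α β i) := by
  simp only [twistLog, map_sum, Derivation.map_smul]
  refine Finset.sum_congr rfl fun k _ => ?_
  rw [← locDeriv_algebraMap, ← locDeriv_algebraMap,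
    derivation_logarithmic_comm _ _ (locDeriv_comm _ i j _) (factor_mul_invFactor α k)]

/-- The action of the free algebra on the letters `x_i`, `∂_i`. -/
def freeAction : FreeAlgebra ℂ (Fin n ⊕ Fin n) →ₐ[ℂ] Module.End ℂ (CoordRing α) :=
  FreeAlgebra.lift ℂ (Sum.elim (coordMul α) (twistedDeriv α β))

lemma freeAction_rel ⦃u v : FreeAlgebra ℂ (Fin n ⊕ Fin n)⦄ (h : WeylRel n u v) :
    freeAction α β u = freeAction α β v := by
  cases h with
  | x_comm i j =>
    ext s
    simp [freeAction, coordMul]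
    ring
  | d_comm i j =>
    ext s
    simp [freeAction, twistedDeriv, Derivation.leibniz, locDeriv_comm _ j i,
      locDeriv_twistLog α β j i]
    ring
  | d_x i j =>
    ext s
    by_cases hij : i = j
    · subst hij
      simp [freeAction, twistedDeriv, coordMul, Derivation.leibniz, locDeriv_algebraMap]
      ring
    · simp [freeAction, twistedDeriv, coordMul, Derivation.leibniz, locDeriv_algebraMap, hij,
        pderiv_X, Ne.symm hij]
      ring

/-- The action of the Weyl algebra on the coefficients `f` of the elements `f α^β`. -/
def weylAction : WeylAlgebra n →ₐ[ℂ] Module.End ℂ (CoordRing α) :=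
  RingQuot.liftAlgHom ℂ ⟨freeAction α β, freeAction_rel α β⟩

/-- The module `M_α^β = ℂ[x]_α α^β`, free of rank one over `ℂ[x]_α` on the symbol `α^β`.
An element `f α^β` is represented by its coefficient `f ∈ ℂ[x]_α`. -/
def TwistedModule (_α : Fin m → MvPolynomial (Fin n) ℂ) (_β : Fin m → ℂ) : Type := CoordRing _α

instance : AddCommGroup (TwistedModule α β) := inferInstanceAs (AddCommGroup (CoordRing α))

instance : Module (CoordRing α) (TwistedModule α β) :=
  inferInstanceAs (Module (CoordRing α) (CoordRing α))

/-- The generator `α^β` of `M_α^β`. -/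
def alphaPow : TwistedModule α β := (1 : CoordRing α)

/-- The `A_n`-module structure of `M_α^β`. -/
instance : Module (WeylAlgebra n) (TwistedModule α β) :=
  Module.compHom (CoordRing α) (weylAction α β).toRingHom

/-- `x_j (f α^β) = (x_j f) α^β`. -/
lemma x_smul (j : Fin n) (f : CoordRing α) :
    WeylAlgebra.x j • (f • alphaPow α β) =
      (algebraMap (MvPolynomial (Fin n) ℂ) (CoordRing α) (X j) * f) • alphaPow α β := by
  change weylAction α β (WeylAlgebra.x j) (f * 1) = (_ * f) * 1
  simp [weylAction, WeylAlgebra.x, freeAction, coordMul]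

/-- `∂_j (f α^β) = (∂_j f + f ∑_k β_k ∂_j(α_k) / α_k) α^β`. -/
lemma d_smul (j : Fin n) (f : CoordRing α) :
    WeylAlgebra.d j • (f • alphaPow α β) =
      (locDeriv (∏ k, α k) j f + f * twistLog α β j) • alphaPow α β := by
  change weylAction α β (WeylAlgebra.d j) (f * 1) = (_ + _) * 1
  simp [weylAction, WeylAlgebra.d, freeAction, twistedDeriv, mul_comm]

end Twisted

/-- The three linear functions `x`, `y`, `x + y + 1` on `ℂ²`. -/
def lineForms : Fin 3 → MvPolynomial (Fin 2) ℂ := ![X 0, X 1, X 0 + X 1 + 1]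

end

noncomputable section

open MvPolynomial

/-! ### Monomials in the three linear forms -/

/-! Choose `κ` with `κ i = β i` whenever `β i` is an integer, and let `I` be the set of these
indices. The ring is spanned by the monomials `∏ ℓ_k ^ (a_k - κ_k)`, so that in the module `a_i` is
the true exponent of `ℓ_i` for `i ∈ I`. The lines are in general position, and their only linear
relation used is `-x - y + (x + y + 1) = 1`.

The Euler field centred at the vertex opposite to `ℓ_i = 0` sends a monomial to a multiple of itself
plus a multiple of the monomial with `a_i` lowered by one (`eulerOp_shiftedMonomial`). For `i ∈ I`
that second multiple vanishes exactly at `a_i = 0`; for `i ∉ I` it never does. Hence the monomials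
with poles, among the lines in `I`, only along `S` span a submodule.

Each `S ⊆ I` with at most two elements contributes one simple factor: an element not coming from
smaller pole sets generates everything (`IsEulerStable.poleSpace_le`), and the factor is nonzero
(`shiftedMonomial_notMem_sup_poleSpace`, a computation at a vertex). Three simultaneous poles give
nothing new, because the relation splits such a monomial into ones of higher degree until some pole
disappears (`sup_poleSubmodule_eq_top`). So the length is the number of subsets of `I` of size at
most two. -/

/-- The coordinate ring of the complement of the three lines. -/
abbrev LineRing : Type := CoordRing lineForms

/-- The linear form `ℓ_k` as a unit of the coordinate ring. -/
def formUnit (k : Fin 3) : LineRingˣ := (isUnit_factor lineForms k).unit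

lemma coe_formUnit (k : Fin 3) :
    (formUnit k : LineRing) = algebraMap (MvPolynomial (Fin 2) ℂ) LineRing (lineForms k) :=
  rfl

/-- The signs in the relation `-x - y + (x + y + 1) = 1`. -/
def formSign : Fin 3 → ℂ := ![-1, -1, 1]

lemma formSign_ne_zero (k : Fin 3) : formSign k ≠ 0 := by
  fin_cases k <;> simp [formSign]

lemma sum_formSign_smul_lineForms : ∑ k, formSign k • lineForms k = 1 := by
  simp [Fin.sum_univ_three, formSign, lineForms]
  ring

lemma sum_formSign_smul_formUnit : ∑ k, formSign k • (formUnit k : LineRing) = 1 := by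
  have h := congrArg (algebraMap (MvPolynomial (Fin 2) ℂ) LineRing) sum_formSign_smul_lineForms
  rw [map_sum, map_one] at h
  rw [← h]
  refine Finset.sum_congr rfl fun k _ => ?_
  rw [coe_formUnit, Algebra.smul_def, Algebra.smul_def, map_mul,
    ← IsScalarTower.algebraMap_apply ℂ (MvPolynomial (Fin 2) ℂ) LineRing]

/-- The Laurent monomial `∏ ℓ_k ^ a_k`. -/
def formMonomial (a : Fin 3 → ℤ) : LineRingˣ := ∏ k, formUnit k ^ a k

lemma formMonomial_add (a b : Fin 3 → ℤ) :
    formMonomial (a + b) = formMonomial a * formMonomial b := by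
  simp [formMonomial, zpow_add, Finset.prod_mul_distrib]

lemma formMonomial_zero : formMonomial 0 = 1 := by
  simp [formMonomial]

lemma formMonomial_single (k : Fin 3) (z : ℤ) : formMonomial (Pi.single k z) = formUnit k ^ z := by
  refine (Finset.prod_eq_single k (fun i _ hi => ?_) (by simp)).trans ?_
  · simp [hi]
  · simp

/-- The logarithmic derivative, as a homomorphism from units to the additive group. -/
def unitLogDeriv {S : Type*} [CommRing S] [Algebra ℂ S] (D : Derivation ℂ S S) :
    Sˣ →* Multiplicative S where
  toFun v := Multiplicative.ofAdd (D v * ↑v⁻¹)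
  map_one' := by simp
  map_mul' v w := by
    rw [← ofAdd_add]
    congr 1
    have hv : (v : S) * ↑v⁻¹ = 1 := v.mul_inv
    have hw : (w : S) * ↑w⁻¹ = 1 := w.mul_inv
    simp only [Units.val_mul, Derivation.leibniz, smul_eq_mul, mul_inv]
    linear_combination (D w * ↑w⁻¹) * hv + (D v * ↑v⁻¹) * hw

lemma derivation_formMonomial (D : Derivation ℂ LineRing LineRing) (a : Fin 3 → ℤ) :
    D (formMonomial a) =
      formMonomial a * ∑ k, (a k : ℂ) • (D (formUnit k) * ↑(formUnit k)⁻¹) := by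
  have h : D (formMonomial a) * ↑(formMonomial a)⁻¹ =
      ∑ k, (a k : ℂ) • (D (formUnit k) * ↑(formUnit k)⁻¹) := by
    have := congrArg Multiplicative.toAdd (map_prod (unitLogDeriv D)
      (fun k => formUnit k ^ a k) Finset.univ)
    simp only [map_zpow, toAdd_prod, toAdd_zpow] at this
    refine this.trans (Finset.sum_congr rfl fun k _ => ?_)
    rw [Int.cast_smul_eq_zsmul]
    rfl
  rw [← h, mul_comm (D _), ← mul_assoc, Units.mul_inv, one_mul]

/-- The basis monomial `∏ ℓ_k ^ (a_k - κ_k)`. -/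
def shiftedMonomial (κ a : Fin 3 → ℤ) : LineRing := formMonomial (a - κ)

lemma shiftedMonomial_add (κ a b : Fin 3 → ℤ) :
    shiftedMonomial κ (a + b) = formMonomial b * shiftedMonomial κ a := by
  rw [shiftedMonomial, add_sub_right_comm, formMonomial_add, Units.val_mul, mul_comm]
  rfl

lemma formUnit_mul_shiftedMonomial (κ a : Fin 3 → ℤ) (k : Fin 3) :
    formUnit k * shiftedMonomial κ a = shiftedMonomial κ (a + Pi.single k 1) := by
  rw [shiftedMonomial_add, formMonomial_single, zpow_one]

lemma inv_formUnit_mul_shiftedMonomial (κ a : Fin 3 → ℤ) (k : Fin 3) :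
    (↑(formUnit k)⁻¹ : LineRing) * shiftedMonomial κ a = shiftedMonomial κ (a - Pi.single k 1) := by
  rw [sub_eq_add_neg, ← Pi.single_neg, shiftedMonomial_add, formMonomial_single, zpow_neg_one]

/-- The relation between the monomials that comes from `∑ ε_k ℓ_k = 1`. -/
lemma sum_formSign_smul_shiftedMonomial (κ a : Fin 3 → ℤ) :
    ∑ k, formSign k • shiftedMonomial κ (a + Pi.single k 1) = shiftedMonomial κ a := by
  simp_rw [← formUnit_mul_shiftedMonomial, ← smul_mul_assoc]
  rw [← Finset.sum_mul, sum_formSign_smul_formUnit, one_mul]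

/-! ### The Euler operators -/

/-- The coefficients of the Euler vector field centred at the vertex opposite to the line
`ℓ_i = 0`. -/
def eulerCoeff (i : Fin 3) (t : Fin 2) : MvPolynomial (Fin 2) ℂ :=
  (![![X 0 + 1, X 1], ![X 0, X 1 + 1], ![X 0, X 1]] : Fin 3 → Fin 2 → MvPolynomial (Fin 2) ℂ) i t

/-- An affine function `ℓ` satisfies `E ℓ = ℓ - ℓ(P)` for the Euler field `E` centred at `P`. Here
`P` lies on the two lines other than `ℓ_i = 0`, and `ℓ_i(P)` is the sign `formSign i`. -/
lemma sum_eulerCoeff_mul_pderiv (i k : Fin 3) :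
    ∑ t, eulerCoeff i t * pderiv t (lineForms k) =
      lineForms k - if i = k then C (formSign i) else 0 := by
  fin_cases i <;> fin_cases k <;>
    simp [eulerCoeff, lineForms, formSign, Fin.sum_univ_two, pderiv_X, Pi.single_apply] <;> ring

/-- The action on coefficients of the Euler vector field centred at the vertex opposite to the
line `ℓ_i = 0`. -/
def eulerOp (β : Fin 3 → ℂ) (i : Fin 3) : Module.End ℂ LineRing :=
  ∑ t, LinearMap.mulLeft ℂ (algebraMap (MvPolynomial (Fin 2) ℂ) LineRing (eulerCoeff i t)) ∘ₗ
    twistedDeriv lineForms β t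

lemma eulerOp_apply (β : Fin 3 → ℂ) (i : Fin 3) (v : LineRing) :
    eulerOp β i v = ∑ t, algebraMap (MvPolynomial (Fin 2) ℂ) LineRing (eulerCoeff i t) *
      twistedDeriv lineForms β t v := by
  simp [eulerOp]

lemma twistedDeriv_shiftedMonomial (β : Fin 3 → ℂ) (κ a : Fin 3 → ℤ) (t : Fin 2) :
    twistedDeriv lineForms β t (shiftedMonomial κ a) =
      ∑ k, (β k - κ k + a k) • (algebraMap (MvPolynomial (Fin 2) ℂ) LineRing
        (pderiv t (lineForms k)) * (↑(formUnit k)⁻¹ * shiftedMonomial κ a)) := by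
  change locDeriv _ t (formMonomial (a - κ) : LineRing) + twistLog lineForms β t * _ = _
  rw [derivation_formMonomial, twistLog, mul_comm]
  change _ * shiftedMonomial κ a + _ = _
  rw [← add_mul, ← Finset.sum_add_distrib, Finset.sum_mul]
  refine Finset.sum_congr rfl fun k _ => ?_
  rw [coe_formUnit, locDeriv_algebraMap, show invFactor lineForms k = ↑(formUnit k)⁻¹ from rfl,
    ← mul_assoc, ← smul_mul_assoc (β k - κ k + a k)]
  congr 1
  refine (add_smul _ _ _).symm.trans ?_
  congr 1
  push_cast [Pi.sub_apply]
  ring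

/-- Lines through the centre contribute only their exponents; the opposite line alone produces a
lower monomial. This isolates the lowering of a single exponent. -/
lemma eulerOp_shiftedMonomial (β : Fin 3 → ℂ) (κ a : Fin 3 → ℤ) (i : Fin 3) :
    eulerOp β i (shiftedMonomial κ a) =
      (∑ k, (β k - κ k + a k)) • shiftedMonomial κ a -
        (formSign i * (β i - κ i + a i)) • shiftedMonomial κ (a - Pi.single i 1) := by
  have h (k : Fin 3) : ∑ t, algebraMap (MvPolynomial (Fin 2) ℂ) LineRing (eulerCoeff i t) *
      algebraMap (MvPolynomial (Fin 2) ℂ) LineRing (pderiv t (lineForms k)) =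
        formUnit k - if i = k then algebraMap ℂ LineRing (formSign i) else 0 := by
    simp_rw [← map_mul]
    rw [← map_sum, sum_eulerCoeff_mul_pderiv, map_sub, coe_formUnit]
    congr 1
    split_ifs
    · rw [IsScalarTower.algebraMap_apply ℂ (MvPolynomial (Fin 2) ℂ) LineRing]
      rfl
    · rw [map_zero]
  simp_rw [eulerOp_apply, twistedDeriv_shiftedMonomial, Finset.mul_sum, mul_smul_comm]
  rw [Finset.sum_comm]
  simp_rw [← Finset.smul_sum, ← mul_assoc, ← Finset.sum_mul, h]
  rw [Finset.sum_smul, ← inv_formUnit_mul_shiftedMonomial]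
  have h2 (k : Fin 3) : (β k - κ k + a k) • ((((formUnit k : LineRing) -
      if i = k then algebraMap ℂ LineRing (formSign i) else 0) * ↑(formUnit k)⁻¹) *
        shiftedMonomial κ a) = (β k - κ k + a k) • shiftedMonomial κ a -
      if i = k then (formSign i * (β i - κ i + a i)) •
        ((↑(formUnit i)⁻¹ : LineRing) * shiftedMonomial κ a) else 0 := by
    rw [sub_mul, Units.mul_inv, sub_mul, one_mul, smul_sub]
    congr 1
    split_ifs with hk
    · subst hk
      rw [mul_assoc, ← Algebra.smul_def, smul_smul, mul_comm]
    · simp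
  rw [Finset.sum_congr rfl fun k _ => h2 k, Finset.sum_sub_distrib]
  simp

/-- Euler fields with different centres differ by a constant field. Hence the Euler operators and
multiplication by the forms recover the whole Weyl algebra action. -/
lemma twistedDeriv_eq_eulerOp_sub (β : Fin 3 → ℂ) (t : Fin 2) (v : LineRing) :
    twistedDeriv lineForms β t v = eulerOp β t.castSucc v - eulerOp β 2 v := by
  simp_rw [eulerOp_apply, Fin.sum_univ_two]
  fin_cases t <;> simp [eulerCoeff] <;> ring

/-! ### Stable subspaces and submodules -/

/-- The subspaces of the coordinate ring that are stable under multiplication by the linear forms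
and under the Euler operators. -/
structure IsEulerStable (β : Fin 3 → ℂ) (V : Submodule ℂ LineRing) : Prop where
  mul_mem : ∀ k, ∀ v ∈ V, (formUnit k : LineRing) * v ∈ V
  euler_mem : ∀ i, ∀ v ∈ V, eulerOp β i v ∈ V

lemma weylAction_x (β : Fin 3 → ℂ) (t : Fin 2) :
    weylAction lineForms β (WeylAlgebra.x t) = coordMul lineForms t := by
  simp [weylAction, WeylAlgebra.x, freeAction]

lemma weylAction_d (β : Fin 3 → ℂ) (t : Fin 2) :
    weylAction lineForms β (WeylAlgebra.d t) = twistedDeriv lineForms β t := by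
  simp [weylAction, WeylAlgebra.d, freeAction]

lemma IsEulerStable.weylAction_mem {β : Fin 3 → ℂ} {V : Submodule ℂ LineRing}
    (hV : IsEulerStable β V) (r : WeylAlgebra 2) : ∀ v ∈ V, weylAction lineForms β r v ∈ V := by
  obtain ⟨w, rfl⟩ := RingQuot.mkAlgHom_surjective ℂ (WeylRel 2) r
  have hw : weylAction lineForms β (RingQuot.mkAlgHom ℂ (WeylRel 2) w) =
      freeAction lineForms β w := by
    simp [weylAction]
  rw [hw]
  induction w using FreeAlgebra.induction with
  | grade0 c =>
    intro v hv
    rw [AlgHom.commutes, Module.algebraMap_end_apply]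
    exact V.smul_mem c hv
  | grade1 s =>
    intro v hv
    rw [freeAction, FreeAlgebra.lift_ι_apply]
    rcases s with t | t
    · fin_cases t
      · exact hV.mul_mem 0 v hv
      · exact hV.mul_mem 1 v hv
    · rw [Sum.elim_inr, twistedDeriv_eq_eulerOp_sub]
      exact V.sub_mem (hV.euler_mem _ v hv) (hV.euler_mem _ v hv)
  | mul p q hp hq =>
    intro v hv
    rw [map_mul]
    exact hp (by simp [weylAction]) _ (hq (by simp [weylAction]) v hv)
  | add p q hp hq =>
    intro v hv
    rw [map_add]
    exact V.add_mem (hp (by simp [weylAction]) v hv) (hq (by simp [weylAction]) v hv)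

/-- The submodule of `M_α^β` given by a stable subspace. -/
def IsEulerStable.toSubmodule {β : Fin 3 → ℂ} {V : Submodule ℂ LineRing}
    (hV : IsEulerStable β V) : Submodule (WeylAlgebra 2) (TwistedModule lineForms β) where
  carrier := {v | (v : LineRing) ∈ V}
  add_mem' := V.add_mem
  zero_mem' := V.zero_mem
  smul_mem' r v hv := hV.weylAction_mem r v hv

/-- The subspace of coefficients of a submodule of `M_α^β`. -/
def coeffSpace {β : Fin 3 → ℂ} (N : Submodule (WeylAlgebra 2) (TwistedModule lineForms β)) :
    Submodule ℂ LineRing where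
  carrier := {v | (v : TwistedModule lineForms β) ∈ N}
  add_mem' := N.add_mem
  zero_mem' := N.zero_mem
  smul_mem' c v hv := by
    have h := N.smul_mem (algebraMap ℂ (WeylAlgebra 2) c) hv
    have h2 : weylAction lineForms β (algebraMap ℂ (WeylAlgebra 2) c) v = c • v := by
      rw [AlgHom.commutes, Module.algebraMap_end_apply]
    change (weylAction lineForms β (algebraMap ℂ (WeylAlgebra 2) c) v) ∈ N at h
    rwa [h2] at h

lemma algebraMap_mul_mem_coeffSpace {β : Fin 3 → ℂ}
    (N : Submodule (WeylAlgebra 2) (TwistedModule lineForms β)) (p : MvPolynomial (Fin 2) ℂ) :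
    ∀ v ∈ coeffSpace N, algebraMap _ LineRing p * v ∈ coeffSpace N := by
  induction p using MvPolynomial.induction_on with
  | C c =>
    intro v hv
    have h : algebraMap (MvPolynomial (Fin 2) ℂ) LineRing (C c) * v = c • v := by
      rw [Algebra.smul_def, IsScalarTower.algebraMap_apply ℂ (MvPolynomial (Fin 2) ℂ) LineRing]
      rfl
    rw [h]
    exact (coeffSpace N).smul_mem c hv
  | add p q hp hq =>
    intro v hv
    rw [map_add, add_mul]
    exact (coeffSpace N).add_mem (hp v hv) (hq v hv)
  | mul_X p t hp =>
    intro v hv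
    rw [map_mul, mul_assoc]
    refine hp _ ?_
    have h := N.smul_mem (WeylAlgebra.x t) hv
    change weylAction lineForms β (WeylAlgebra.x t) v ∈ N at h
    rwa [weylAction_x] at h

lemma isEulerStable_coeffSpace {β : Fin 3 → ℂ}
    (N : Submodule (WeylAlgebra 2) (TwistedModule lineForms β)) :
    IsEulerStable β (coeffSpace N) where
  mul_mem k v hv := algebraMap_mul_mem_coeffSpace N (lineForms k) v hv
  euler_mem i v hv := by
    rw [eulerOp_apply]
    refine Submodule.sum_mem _ fun t _ => algebraMap_mul_mem_coeffSpace N _ _ ?_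
    have h := N.smul_mem (WeylAlgebra.d t) hv
    change weylAction lineForms β (WeylAlgebra.d t) v ∈ N at h
    rwa [weylAction_d] at h

/-! ### Monomials in stable subspaces -/

section Stable

variable {β : Fin 3 → ℂ} {κ : Fin 3 → ℤ} {V : Submodule ℂ LineRing}

lemma IsEulerStable.raise_mem (hV : IsEulerStable β V) {a : Fin 3 → ℤ} (k : Fin 3)
    (ha : shiftedMonomial κ a ∈ V) (n : ℕ) : shiftedMonomial κ (a + Pi.single k (n : ℤ)) ∈ V := by
  induction n with
  | zero => simpa using ha
  | succ n ih =>
    have h := hV.mul_mem k _ ih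
    rwa [formUnit_mul_shiftedMonomial, add_assoc, ← Pi.single_add] at h

lemma IsEulerStable.lower_one_mem (hV : IsEulerStable β V) {a : Fin 3 → ℤ} (k : Fin 3)
    (hk : β k - κ k + a k ≠ 0) (ha : shiftedMonomial κ a ∈ V) :
    shiftedMonomial κ (a - Pi.single k 1) ∈ V := by
  have h := V.sub_mem (V.smul_mem (∑ k, (β k - κ k + a k)) ha) (hV.euler_mem k _ ha)
  rw [eulerOp_shiftedMonomial, sub_sub_cancel] at h
  exact (V.smul_mem_iff (mul_ne_zero (formSign_ne_zero k) hk)).mp h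

lemma IsEulerStable.lower_mem (hV : IsEulerStable β V) {a : Fin 3 → ℤ} (k : Fin 3) (n : ℕ)
    (hk : ∀ j < n, β k - κ k + (a k - j : ℤ) ≠ 0) (ha : shiftedMonomial κ a ∈ V) :
    shiftedMonomial κ (a - Pi.single k (n : ℤ)) ∈ V := by
  induction n with
  | zero => simpa using ha
  | succ n ih =>
    have h := hV.lower_one_mem k (by simpa using hk n n.lt_succ_self)
      (ih fun j hj => hk j (hj.trans n.lt_succ_self))
    rwa [sub_sub, ← Pi.single_add] at h

variable {I : Finset (Fin 3)}

/-- Raising is multiplication by `ℓ_k`. Lowering is blocked only by a zero coefficient, which occurs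
only for `k ∈ I` at the step from `0` to `-1`; `hz` excludes crossing it. -/
lemma IsEulerStable.update_mem (hV : IsEulerStable β V) (hI : ∀ i ∈ I, β i = κ i)
    (hI' : ∀ i ∉ I, ∀ z : ℤ, β i - κ i + z ≠ 0) {a : Fin 3 → ℤ} (k : Fin 3) (z : ℤ)
    (hz : k ∈ I → z < 0 → a k < 0) (ha : shiftedMonomial κ a ∈ V) :
    shiftedMonomial κ (Function.update a k z) ∈ V := by
  rcases le_total (a k) z with h | h
  · obtain ⟨n, hn⟩ := Int.eq_ofNat_of_zero_le (sub_nonneg.mpr h)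
    convert hV.raise_mem k ha n using 2
    ext i
    rcases eq_or_ne i k with rfl | hi
    · simp; omega
    · simp [hi]
  · obtain ⟨n, hn⟩ := Int.eq_ofNat_of_zero_le (sub_nonneg.mpr h)
    convert hV.lower_mem k n (fun j hj => ?_) ha using 2
    · ext i
      rcases eq_or_ne i k with rfl | hi
      · simp; omega
      · simp [hi]
    · by_cases hk : k ∈ I
      · rw [hI k hk, sub_self, zero_add, Int.cast_ne_zero]
        intro h0
        have := hz hk (by omega)
        omega
      · exact hI' k hk _

lemma IsEulerStable.monomial_mem (hV : IsEulerStable β V) (hI : ∀ i ∈ I, β i = κ i)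
    (hI' : ∀ i ∉ I, ∀ z : ℤ, β i - κ i + z ≠ 0) {a b : Fin 3 → ℤ}
    (hab : ∀ i ∈ I, b i < 0 → a i < 0) (ha : shiftedMonomial κ a ∈ V) :
    shiftedMonomial κ b ∈ V := by
  have h0 := hV.update_mem hI hI' 0 (b 0) (hab 0) ha
  have h1 := hV.update_mem hI hI' 1 (b 1) (by simpa using hab 1) h0
  have h2 := hV.update_mem hI hI' 2 (b 2) (by simpa using hab 2) h1
  convert h2 using 2
  ext i
  fin_cases i <;> simp [Function.update]

/-- In the difference of two Euler operators the total degree cancels. What remains acts like a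
diagonal operator reading off the exponent `b i`, up to the shift by `ℓ_k`. -/
lemma euler_sub_euler_shiftedMonomial (β : Fin 3 → ℂ) (κ b : Fin 3 → ℤ) (i k : Fin 3) :
    (formUnit i : LineRing) * (formUnit k * (eulerOp β k (shiftedMonomial κ b) -
      eulerOp β i (shiftedMonomial κ b))) +
        (formSign k * (β k - κ k + b k)) • (formUnit i * shiftedMonomial κ b) =
      (formSign i * (β i - κ i + b i)) • (formUnit k * shiftedMonomial κ b) := by
  have hi : (formUnit i : LineRing) * ↑(formUnit i)⁻¹ = 1 := (formUnit i).mul_inv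
  have hk : (formUnit k : LineRing) * ↑(formUnit k)⁻¹ = 1 := (formUnit k).mul_inv
  rw [eulerOp_shiftedMonomial, eulerOp_shiftedMonomial, ← inv_formUnit_mul_shiftedMonomial,
    ← inv_formUnit_mul_shiftedMonomial]
  simp only [Algebra.smul_def]
  linear_combination
    (algebraMap ℂ LineRing (formSign i * (β i - κ i + b i)) *
      formUnit k * shiftedMonomial κ b) * hi -
    (algebraMap ℂ LineRing (formSign k * (β k - κ k + b k)) *
      formUnit i * shiftedMonomial κ b) * hk

/-- A linear combination of monomials with a common exponent of `ℓ_k` that lies in a stable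
subspace has all its monomials there, up to powers of `ℓ_k`. -/
lemma IsEulerStable.exists_monomial_mem (hV : IsEulerStable β V) (k : Fin 3) (n : ℤ)
    (A : Finset (Fin 3 → ℤ)) : ∀ (c : (Fin 3 → ℤ) → ℂ) (r : ℕ), (∀ a ∈ A, a k = n) →
      ∑ a ∈ A, c a • shiftedMonomial κ (a + Pi.single k (r : ℤ)) ∈ V →
      ∀ a ∈ A, c a ≠ 0 → ∃ s : ℕ, shiftedMonomial κ (a + Pi.single k (s : ℤ)) ∈ V := by
  induction A using Finset.strongInduction with
  | H A ih =>
    intro c r hA hw a ha hca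
    by_cases hsub : ∃ b ∈ A, b ≠ a
    swap
    · have hA' : A = {a} := by
        push Not at hsub
        exact Finset.eq_singleton_iff_unique_mem.mpr ⟨ha, hsub⟩
      rw [hA', Finset.sum_singleton] at hw
      exact ⟨r, (V.smul_mem_iff hca).mp hw⟩
    obtain ⟨b, hb, hba⟩ := hsub
    obtain ⟨i, hi⟩ := Function.ne_iff.mp hba
    have hik : i ≠ k := by
      rintro rfl
      exact hi ((hA b hb).trans (hA a ha).symm)
    set w := ∑ a ∈ A, c a • shiftedMonomial κ (a + Pi.single k (r : ℤ)) with hwdef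
    -- Eigenvalue elimination: since all terms share the exponent of `ℓ_k`, this operator multiplies
    -- the term at `a` by `formSign i * (a i - b i)` and by `ℓ_k`. It kills `b` and keeps the chosen
    -- `a`.
    have hmem : (formUnit i : LineRing) * (formUnit k * (eulerOp β k w - eulerOp β i w)) +
        (formSign k * (β k - κ k + (n + r : ℤ))) • (formUnit i * w) -
          (formSign i * (β i - κ i + b i)) • (formUnit k * w) ∈ V :=
      V.sub_mem (V.add_mem (hV.mul_mem _ _ (hV.mul_mem _ _
        (V.sub_mem (hV.euler_mem _ _ hw) (hV.euler_mem _ _ hw))))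
        (V.smul_mem _ (hV.mul_mem _ _ hw))) (V.smul_mem _ (hV.mul_mem _ _ hw))
    have heq : (formUnit i : LineRing) * (formUnit k * (eulerOp β k w - eulerOp β i w)) +
        (formSign k * (β k - κ k + (n + r : ℤ))) • (formUnit i * w) -
          (formSign i * (β i - κ i + b i)) • (formUnit k * w) =
        ∑ a ∈ A.erase b, (c a * (formSign i * (a i - b i))) •
          shiftedMonomial κ (a + Pi.single k ((r + 1 : ℕ) : ℤ)) := by
      rw [Finset.sum_erase _ (by simp)]
      simp only [hwdef, map_sum, map_smul, Finset.mul_sum, Finset.smul_sum, mul_smul_comm,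
        ← Finset.sum_sub_distrib, ← Finset.sum_add_distrib]
      refine Finset.sum_congr rfl fun a ha => ?_
      have h := euler_sub_euler_shiftedMonomial β κ (a + Pi.single k (r : ℤ)) i k
      have h1 : (a + Pi.single k (r : ℤ) : Fin 3 → ℤ) k = n + r := by simp [hA a ha]
      have h2 : (a + Pi.single k (r : ℤ) : Fin 3 → ℤ) i = a i := by simp [hik]
      rw [h1, h2] at h
      have h3 : shiftedMonomial κ (a + Pi.single k ((r + 1 : ℕ) : ℤ)) =
          formUnit k * shiftedMonomial κ (a + Pi.single k (r : ℤ)) := by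
        rw [formUnit_mul_shiftedMonomial, add_assoc, ← Pi.single_add]
        rfl
      rw [h3]
      have h4 : algebraMap ℂ LineRing (c a * (formSign i * (a i - b i))) =
        algebraMap ℂ LineRing (c a) * (algebraMap ℂ LineRing (formSign i * (β i - κ i + a i)) -
          algebraMap ℂ LineRing (formSign i * (β i - κ i + b i))) := by
        rw [← map_sub, ← map_mul]
        congr 1
        ring
      simp only [Algebra.smul_def] at h ⊢
      rw [h4]
      linear_combination algebraMap ℂ LineRing (c a) * h
    rw [heq] at hmem
    refine ih (A.erase b) (Finset.erase_ssubset hb) _ (r + 1)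
      (fun a ha => hA a (Finset.mem_of_mem_erase ha)) hmem a
      (Finset.mem_erase.mpr ⟨hba.symm, ha⟩) (mul_ne_zero hca (mul_ne_zero (formSign_ne_zero i) ?_))
    rw [sub_ne_zero]
    exact_mod_cast hi.symm

end Stable

/-! ### Subspaces with prescribed poles -/

/-- The set of those indices in `I` at which the exponent is negative. -/
def negSet (I : Finset (Fin 3)) (a : Fin 3 → ℤ) : Finset (Fin 3) := I.filter fun i => a i < 0

lemma mem_negSet {I : Finset (Fin 3)} {a : Fin 3 → ℤ} {i : Fin 3} :
    i ∈ negSet I a ↔ i ∈ I ∧ a i < 0 :=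
  Finset.mem_filter

lemma negSet_anti (I : Finset (Fin 3)) {a b : Fin 3 → ℤ} (h : a ≤ b) : negSet I b ⊆ negSet I a :=
  fun i hi => mem_negSet.mpr ⟨(mem_negSet.mp hi).1, (h i).trans_lt (mem_negSet.mp hi).2⟩

/-- The span of the monomials that have, among the lines in `I`, poles along those in `S` only. -/
def poleSpace (κ : Fin 3 → ℤ) (I S : Finset (Fin 3)) : Submodule ℂ LineRing :=
  Submodule.span ℂ (shiftedMonomial κ '' {a | negSet I a ⊆ S})

lemma shiftedMonomial_mem_poleSpace {κ : Fin 3 → ℤ} {I S : Finset (Fin 3)} {a : Fin 3 → ℤ}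
    (ha : negSet I a ⊆ S) : shiftedMonomial κ a ∈ poleSpace κ I S :=
  Submodule.subset_span ⟨a, ha, rfl⟩

lemma poleSpace_le_iff {κ : Fin 3 → ℤ} {I S : Finset (Fin 3)} {V : Submodule ℂ LineRing} :
    poleSpace κ I S ≤ V ↔ ∀ a, negSet I a ⊆ S → shiftedMonomial κ a ∈ V := by
  simp only [poleSpace, Submodule.span_le, Set.image_subset_iff]
  rfl

lemma le_add_single (a : Fin 3 → ℤ) (k : Fin 3) {z : ℤ} (hz : 0 ≤ z) : a ≤ a + Pi.single k z :=
  le_add_of_nonneg_right (Pi.single_nonneg.mpr hz)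

section Poles

variable {β : Fin 3 → ℂ} {κ : Fin 3 → ℤ} {I : Finset (Fin 3)}

/-- Raising exponents never creates poles, and the lowering that would create one along a line in
`I` has coefficient zero. -/
lemma isEulerStable_poleSpace (hI : ∀ i ∈ I, β i = κ i) (S : Finset (Fin 3)) :
    IsEulerStable β (poleSpace κ I S) where
  mul_mem k := by
    suffices h : poleSpace κ I S ≤
        (poleSpace κ I S).comap (LinearMap.mulLeft ℂ (formUnit k : LineRing)) from h
    refine poleSpace_le_iff.mpr fun a ha => ?_
    rw [Submodule.mem_comap, LinearMap.mulLeft_apply, formUnit_mul_shiftedMonomial]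
    exact shiftedMonomial_mem_poleSpace ((negSet_anti I (le_add_single a k zero_le_one)).trans ha)
  euler_mem i := by
    suffices h : poleSpace κ I S ≤ (poleSpace κ I S).comap (eulerOp β i) from h
    refine poleSpace_le_iff.mpr fun a ha => ?_
    rw [Submodule.mem_comap, eulerOp_shiftedMonomial]
    refine Submodule.sub_mem _ (Submodule.smul_mem _ _ (shiftedMonomial_mem_poleSpace ha)) ?_
    by_cases h0 : β i - κ i + a i = 0
    · rw [h0, mul_zero, zero_smul]
      exact Submodule.zero_mem _
    refine Submodule.smul_mem _ _ (shiftedMonomial_mem_poleSpace fun j hj => ?_)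
    rw [mem_negSet] at hj
    refine ha (mem_negSet.mpr ⟨hj.1, ?_⟩)
    rcases eq_or_ne j i with rfl | hji
    · rw [hI j hj.1, sub_self, zero_add, Int.cast_eq_zero] at h0
      have := hj.2
      simp at this
      omega
    · simpa [hji] using hj.2

/-- The elements of `poleSpace` are combinations of monomials with a common exponent of `ℓ_k`,
if there is no pole along that line. -/
lemma exists_mem_span_of_mem_poleSpace {S : Finset (Fin 3)} {k : Fin 3} (hk : k ∉ S)
    {v : LineRing} (hv : v ∈ poleSpace κ I S) :
    ∃ n : ℤ, v ∈ Submodule.span ℂ (shiftedMonomial κ '' {a | a k = n ∧ negSet I a ⊆ S}) := by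
  set W : ℤ → Submodule ℂ LineRing := fun n =>
    Submodule.span ℂ (shiftedMonomial κ '' {a | a k = n ∧ negSet I a ⊆ S}) with hW
  have hmem {n : ℤ} {a : Fin 3 → ℤ} (h1 : a k = n) (h2 : negSet I a ⊆ S) :
      shiftedMonomial κ a ∈ W n := Submodule.subset_span ⟨a, ⟨h1, h2⟩, rfl⟩
  have hstep (n : ℤ) (hn : k ∈ I → 0 ≤ n) : W (n + 1) ≤ W n := by
    refine Submodule.span_le.mpr ?_
    rintro _ ⟨a, ⟨hak, haS⟩, rfl⟩
    have hb : negSet I (a - Pi.single k 1) ⊆ S := fun j hj => by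
      rw [mem_negSet] at hj
      rcases eq_or_ne j k with rfl | hjk
      · have h1 := hn hj.1
        have h2 := hj.2
        simp at h2
        omega
      · exact haS (mem_negSet.mpr ⟨hj.1, by simpa [hjk] using hj.2⟩)
    -- Solved for the monomial at `a`, this relation involves only monomials whose `k`-th exponent
    -- is `n`; the guard `0 ≤ n` prevents a pole along `ℓ_k`.
    have hrel := sum_formSign_smul_shiftedMonomial κ (a - Pi.single k 1)
    rw [← Finset.add_sum_erase _ _ (Finset.mem_univ k), sub_add_cancel] at hrel
    refine ((W n).smul_mem_iff (formSign_ne_zero k)).mp ?_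
    rw [eq_sub_of_add_eq hrel]
    refine (W n).sub_mem (hmem (by simp [hak]) hb)
      ((W n).sum_mem fun i hi => (W n).smul_mem _ (hmem ?_ ?_))
    · simp [hak, (Finset.ne_of_mem_erase hi).symm]
    · exact (negSet_anti I (le_add_single _ i zero_le_one)).trans hb
  have hanti (n : ℤ) (hn : k ∈ I → 0 ≤ n) (d : ℕ) : W (n + d) ≤ W n := by
    induction d with
    | zero => simp
    | succ d ih =>
      refine le_trans ?_ ih
      rw [Nat.cast_succ, ← add_assoc]
      exact hstep _ fun h => add_nonneg (hn h) (Int.natCast_nonneg d)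
  have hanti' {n n' : ℤ} (hn : k ∈ I → 0 ≤ n) (h : n ≤ n') : W n' ≤ W n := by
    obtain ⟨d, hd⟩ := Int.eq_ofNat_of_zero_le (sub_nonneg.mpr h)
    obtain rfl : n' = n + d := by omega
    exact hanti n hn d
  suffices h : ∃ n : ℤ, (k ∈ I → 0 ≤ n) ∧ v ∈ W n from ⟨h.choose, h.choose_spec.2⟩
  induction hv using Submodule.span_induction with
  | mem v hv =>
    obtain ⟨a, ha, rfl⟩ := hv
    refine ⟨a k, fun hkI => ?_, hmem rfl ha⟩
    by_contra hneg
    exact hk (ha (mem_negSet.mpr ⟨hkI, not_le.mp hneg⟩))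
  | zero => exact ⟨0, fun _ => le_rfl, Submodule.zero_mem _⟩
  | add v w _ _ hv hw =>
    obtain ⟨n, hn, hv⟩ := hv
    obtain ⟨n', hn', hw⟩ := hw
    have hmin : k ∈ I → 0 ≤ min n n' := fun h => le_min (hn h) (hn' h)
    exact ⟨min n n', hmin, Submodule.add_mem _ (hanti' hmin (min_le_left _ _) hv)
      (hanti' hmin (min_le_right _ _) hw)⟩
  | smul c v _ hv =>
    obtain ⟨n, hn, hv⟩ := hv
    exact ⟨n, hn, Submodule.smul_mem _ _ hv⟩

/-- An element with poles along `S` generates the whole of `poleSpace κ I S`, modulo the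
subspaces with fewer poles, unless it belongs to their sum. -/
lemma IsEulerStable.poleSpace_le {V F : Submodule ℂ LineRing} (hV : IsEulerStable β V)
    (hI : ∀ i ∈ I, β i = κ i) (hI' : ∀ i ∉ I, ∀ z : ℤ, β i - κ i + z ≠ 0)
    {S : Finset (Fin 3)} {k : Fin 3} (hk : k ∉ S) (hF : ∀ T, T ⊂ S → poleSpace κ I T ≤ F)
    {v : LineRing} (hv : v ∈ poleSpace κ I S) (hvV : v ∈ V) (hvF : v ∉ F) :
    poleSpace κ I S ≤ V := by
  obtain ⟨n, hn⟩ := exists_mem_span_of_mem_poleSpace hk hv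
  obtain ⟨c, hc, rfl⟩ := (Finsupp.mem_span_image_iff_linearCombination ℂ).mp hn
  rw [Finsupp.linearCombination_apply, Finsupp.sum] at hvV hvF
  have hc' (a : Fin 3 → ℤ) (ha : a ∈ c.support) : a k = n ∧ negSet I a ⊆ S := hc ha
  obtain ⟨a, ha, haF⟩ : ∃ a ∈ c.support, shiftedMonomial κ a ∉ F := by
    by_contra! h
    exact hvF (F.sum_mem fun a ha => F.smul_mem _ (h a ha))
  have haS : negSet I a = S := by
    by_contra hne
    exact haF (hF _ (lt_of_le_of_ne (hc' a ha).2 hne)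
      (shiftedMonomial_mem_poleSpace (Finset.Subset.refl _)))
  obtain ⟨s, hs⟩ := hV.exists_monomial_mem (κ := κ) k n c.support c 0 (fun a ha => (hc' a ha).1)
    (by simpa using hvV) a ha (Finsupp.mem_support_iff.mp ha)
  -- The unknown power of `ℓ_k` is harmless: as `k ∉ S`, the exponents along `S` are still negative.
  refine poleSpace_le_iff.mpr fun b hb => hV.monomial_mem hI hI' (fun i hi hbi => ?_) hs
  have hiS : i ∈ S := hb (mem_negSet.mpr ⟨hi, hbi⟩)
  have hik : i ≠ k := fun h => hk (h ▸ hiS)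
  rw [← haS, mem_negSet] at hiS
  simpa [hik] using hiS.2

end Poles

/-! ### Separation of poles -/

/-- The span of the monomials without a pole along `ℓ_i = 0`. -/
def regularSpace (κ : Fin 3 → ℤ) (i : Fin 3) : Submodule ℂ LineRing :=
  Submodule.span ℂ (shiftedMonomial κ '' {a | 0 ≤ a i})

lemma formMonomial_natCast (e : Fin 3 → ℕ) :
    (formMonomial (fun t => (e t : ℤ)) : LineRing) =
      algebraMap (MvPolynomial (Fin 2) ℂ) LineRing (∏ t, lineForms t ^ e t) := by
  rw [map_prod, formMonomial, Units.coe_prod]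
  refine Finset.prod_congr rfl fun t _ => ?_
  rw [zpow_natCast, map_pow, Units.val_pow_eq_pow_val, coe_formUnit]

/-- Clearing denominators by a common power `N` leaves a factor `ℓ_i ^ N` when there is no pole
along `ℓ_i`. Allowing all large `N` makes the property additive. -/
lemma exists_of_mem_regularSpace {κ : Fin 3 → ℤ} {i : Fin 3} {v : LineRing}
    (hv : v ∈ regularSpace κ i) : ∃ N₀ : ℕ, ∀ N ≥ N₀, ∃ f : MvPolynomial (Fin 2) ℂ,
      formMonomial (fun t => κ t + N) * v = algebraMap _ LineRing (lineForms i ^ N * f) := by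
  induction hv using Submodule.span_induction with
  | mem v hv =>
    obtain ⟨a, ha, rfl⟩ := hv
    have ha : 0 ≤ a i := ha
    refine ⟨∑ t, (a t).natAbs, fun N hN => ?_⟩
    have hle (t : Fin 3) : 0 ≤ a t + N := by
      have := Finset.single_le_sum (f := fun t => (a t).natAbs) (fun _ _ => Nat.zero_le _)
        (Finset.mem_univ t)
      omega
    have hle' (t : Fin 3) : 0 ≤ a t + N - if t = i then (N : ℤ) else 0 := by
      have := hle t
      split_ifs with h
      · subst h; omega
      · omega
    refine ⟨∏ t, lineForms t ^ (a t + N - if t = i then (N : ℤ) else 0).toNat, ?_⟩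
    rw [map_mul, ← formMonomial_natCast, map_pow, ← coe_formUnit, ← Units.val_pow_eq_pow_val,
      ← zpow_natCast, ← formMonomial_single, shiftedMonomial, ← Units.val_mul, ← Units.val_mul,
      ← formMonomial_add, ← formMonomial_add]
    congr 2
    ext t
    simp only [Pi.add_apply, Pi.sub_apply, Int.toNat_of_nonneg (hle' t), Pi.single_apply]
    ring
  | zero => exact ⟨0, fun N _ => ⟨0, by simp⟩⟩
  | add v w _ _ hv hw =>
    obtain ⟨N₁, h₁⟩ := hv
    obtain ⟨N₂, h₂⟩ := hw
    refine ⟨max N₁ N₂, fun N hN => ?_⟩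
    obtain ⟨f, hf⟩ := h₁ N ((le_max_left _ _).trans hN)
    obtain ⟨g, hg⟩ := h₂ N ((le_max_right _ _).trans hN)
    exact ⟨f + g, by rw [mul_add, hf, hg, ← map_add, mul_add]⟩
  | smul c v _ hv =>
    obtain ⟨N₀, h⟩ := hv
    refine ⟨N₀, fun N hN => ?_⟩
    obtain ⟨f, hf⟩ := h N hN
    refine ⟨c • f, ?_⟩
    rw [mul_smul_comm, hf, mul_smul_comm, Algebra.smul_def, Algebra.smul_def,
      map_mul _ (algebraMap ℂ _ c),
      ← IsScalarTower.algebraMap_apply ℂ (MvPolynomial (Fin 2) ℂ) LineRing]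

lemma lineForms_ne_zero (k : Fin 3) : lineForms k ≠ 0 := by
  have h : aeval (![1, 1] : Fin 2 → ℂ) (lineForms k) ≠ 0 := by
    fin_cases k <;> norm_num [lineForms]
  rintro h0
  simp [h0] at h

lemma algebraMap_lineRing_injective :
    Function.Injective (algebraMap (MvPolynomial (Fin 2) ℂ) LineRing) :=
  IsLocalization.injective (M := Submonoid.powers (∏ k, lineForms k)) LineRing
    (powers_le_nonZeroDivisors_of_noZeroDivisors
      (Finset.prod_ne_zero_iff.mpr fun k _ => lineForms_ne_zero k))

/-- The linear forms in terms of `ℓ_i` and `ℓ_j`. -/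
def formCoord (i j t : Fin 3) : Polynomial (Polynomial ℂ) :=
  if t = i then Polynomial.X else if t = j then Polynomial.C Polynomial.X else
    formSign t • (1 - formSign i • Polynomial.X - formSign j • Polynomial.C Polynomial.X)

lemma aeval_formCoord {i j : Fin 3} (hij : i ≠ j) (t : Fin 3) :
    aeval ![formCoord i j 0, formCoord i j 1] (lineForms t) = formCoord i j t := by
  fin_cases t
  · simp [lineForms]
  · simp [lineForms]
  · fin_cases i <;> fin_cases j <;> first | exact absurd rfl hij | skip
    all_goals simp [lineForms, formCoord, formSign]
    all_goals try ring

/-- With `ℓ_i`, `ℓ_j` as coordinates, the third form is nonzero at their common zero. The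
coefficient of `ℓ_i ^ e i * ℓ_j ^ e j` is therefore nonzero on the left and zero on the right. -/
lemma prod_lineForms_pow_ne {i j : Fin 3} (hij : i ≠ j) (e : Fin 3 → ℕ) {N : ℕ} (hi : e i < N)
    (hj : e j < N) (f g : MvPolynomial (Fin 2) ℂ) :
    ∏ t, lineForms t ^ e t ≠ lineForms i ^ N * f + lineForms j ^ N * g := by
  intro h
  have hi0 : formCoord i j i = Polynomial.X := by simp [formCoord]
  have hj0 : formCoord i j j = Polynomial.C Polynomial.X := by simp [formCoord, hij.symm]
  have h := congrArg (aeval ![formCoord i j 0, formCoord i j 1]) h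
  simp only [map_prod, map_add, map_mul, map_pow, aeval_formCoord hij] at h
  rw [← Finset.mul_prod_erase _ _ (Finset.mem_univ i),
    ← Finset.mul_prod_erase _ _ (Finset.mem_erase.mpr ⟨hij.symm, Finset.mem_univ j⟩), hi0, hj0,
    ← Polynomial.C_pow, ← Polynomial.C_pow] at h
  set p := ∏ t ∈ (Finset.univ.erase i).erase j, formCoord i j t ^ e t with hp
  have hp0 : (p.coeff 0).coeff 0 ≠ 0 := by
    have heval : (p.coeff 0).coeff 0 =
        (Polynomial.constantCoeff.comp Polynomial.constantCoeff) p := rfl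
    rw [heval, hp, map_prod, Finset.prod_ne_zero_iff]
    intro t ht
    have htj : t ≠ j := (Finset.mem_erase.mp ht).1
    have hti : t ≠ i := (Finset.mem_erase.mp (Finset.mem_erase.mp ht).2).1
    rw [map_pow]
    refine pow_ne_zero _ ?_
    simp [formCoord, hti, htj, formSign_ne_zero]
  have h := congrArg (fun q => (Polynomial.coeff q (e i)).coeff (e j)) h
  simp only [Polynomial.coeff_add, Polynomial.coeff_X_pow_mul', Polynomial.coeff_C_mul,
    le_refl, if_true, Nat.sub_self, hi.not_ge, hj.not_ge, if_false, Polynomial.coeff_zero,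
    add_zero] at h
  exact hp0 h

lemma shiftedMonomial_notMem_sup {κ : Fin 3 → ℤ} {i j : Fin 3} (hij : i ≠ j) {m : Fin 3 → ℤ}
    (hi : m i < 0) (hj : m j < 0) :
    shiftedMonomial κ m ∉ regularSpace κ i ⊔ regularSpace κ j := by
  intro h
  obtain ⟨v, hv, w, hw, h⟩ := Submodule.mem_sup.mp h
  obtain ⟨N₁, h₁⟩ := exists_of_mem_regularSpace hv
  obtain ⟨N₂, h₂⟩ := exists_of_mem_regularSpace hw
  set N := max (max N₁ N₂) (∑ t, (m t).natAbs) with hN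
  obtain ⟨f, hf⟩ := h₁ N ((le_max_left _ _).trans (le_max_left _ _))
  obtain ⟨g, hg⟩ := h₂ N ((le_max_right _ _).trans (le_max_left _ _))
  have hle (t : Fin 3) : 0 ≤ m t + N := by
    have h1 := Finset.single_le_sum (f := fun t => (m t).natAbs) (fun _ _ => Nat.zero_le _)
      (Finset.mem_univ t)
    have h2 : ∑ t, (m t).natAbs ≤ N := le_max_right _ _
    omega
  have hprod : (formMonomial (fun t => κ t + N) : LineRing) * shiftedMonomial κ m =
      algebraMap (MvPolynomial (Fin 2) ℂ) LineRing
        (∏ t, lineForms t ^ (m t + N).toNat) := by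
    rw [← formMonomial_natCast, shiftedMonomial, ← Units.val_mul, ← formMonomial_add]
    congr 2
    ext t
    simp only [Pi.add_apply, Pi.sub_apply, Int.toNat_of_nonneg (hle t)]
    ring
  rw [← h, mul_add, hf, hg, ← map_add] at hprod
  have hi' := hle i
  have hj' := hle j
  exact prod_lineForms_pow_ne hij _ (by omega) (by omega) f g
    (algebraMap_lineRing_injective hprod).symm

/-- The monomial with simple poles along `S` is not a sum of elements with poles along sets of
lines that do not contain `S`. -/
lemma shiftedMonomial_notMem_sup_poleSpace {κ : Fin 3 → ℤ} {I S : Finset (Fin 3)} (hS : S ⊆ I)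
    {k : Fin 3} (hk : k ∉ S) (𝒮 : Finset (Finset (Fin 3))) (h𝒮 : ∀ T ∈ 𝒮, ¬ S ⊆ T) :
    shiftedMonomial κ (fun t => if t ∈ S then -1 else 0) ∉ 𝒮.sup (poleSpace κ I) := by
  obtain ⟨i, j, hij, hcover⟩ : ∃ i j : Fin 3, i ≠ j ∧ ∀ t, t ≠ k → t = i ∨ t = j := by
    clear hk
    decide +revert
  -- Multiplication by this monomial gives the test monomial exponent `-1` on every line. A
  -- generator for `T` stays regular along some line of `S \ T`, which is `i` or `j` because `k ∉
  -- S`.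
  set z : Fin 3 → ℤ := fun t => if t ∈ S then 0 else -1 with hz
  have hle : 𝒮.sup (poleSpace κ I) ≤ (regularSpace κ i ⊔ regularSpace κ j).comap
      (LinearMap.mulLeft ℂ (formMonomial z : LineRing)) := by
    refine Finset.sup_le fun T hT => poleSpace_le_iff.mpr fun a ha => ?_
    obtain ⟨t, htS, htT⟩ := Finset.not_subset.mp (h𝒮 T hT)
    have hat : 0 ≤ (a + z) t := by
      have h0 : ¬ a t < 0 := fun h => htT (ha (mem_negSet.mpr ⟨hS htS, h⟩))
      simpa [hz, htS] using h0
    rw [Submodule.mem_comap, LinearMap.mulLeft_apply, ← shiftedMonomial_add]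
    rcases hcover t (fun h => hk (h ▸ htS)) with rfl | rfl
    · exact Submodule.mem_sup_left (Submodule.subset_span ⟨_, hat, rfl⟩)
    · exact Submodule.mem_sup_right (Submodule.subset_span ⟨_, hat, rfl⟩)
  intro h
  have h := hle h
  rw [Submodule.mem_comap, LinearMap.mulLeft_apply, ← shiftedMonomial_add] at h
  refine shiftedMonomial_notMem_sup hij ?_ ?_ h
  · by_cases hi : i ∈ S <;> simp [hz, hi]
  · by_cases hj : j ∈ S <;> simp [hz, hj]

/-! ### The length of the module -/

lemma length_submodule_of_covBy {R M : Type*} [Ring R] [AddCommGroup M] [Module R M]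
    {N P : Submodule R M} (h : N ⋖ P) : Module.length R P = Module.length R N + 1 := by
  have := (covBy_iff_quot_is_simple h.le).mp h
  rw [Module.length_eq_add_of_exact (Submodule.inclusion h.le)
    (N.submoduleOf P).mkQ (Submodule.inclusion_injective h.le) (Submodule.mkQ_surjective _)
    (LinearMap.exact_iff.mpr (by rw [Submodule.ker_mkQ, Submodule.range_inclusion]; rfl))]
  congr 1
  exact Module.length_eq_one_iff.mpr this

section Length

variable {β : Fin 3 → ℂ} {κ : Fin 3 → ℤ} {I : Finset (Fin 3)}

/-- The submodule of `M_α^β` spanned by the monomials that have, among the lines in `I`, poles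
along those in `S` only. -/
def poleSubmodule (hI : ∀ i ∈ I, β i = κ i) (S : Finset (Fin 3)) :
    Submodule (WeylAlgebra 2) (TwistedModule lineForms β) :=
  (isEulerStable_poleSpace hI S).toSubmodule

lemma poleSubmodule_le_iff (hI : ∀ i ∈ I, β i = κ i) {S : Finset (Fin 3)}
    {N : Submodule (WeylAlgebra 2) (TwistedModule lineForms β)} :
    poleSubmodule hI S ≤ N ↔ poleSpace κ I S ≤ coeffSpace N :=
  Iff.rfl

lemma coeffSpace_sup_poleSubmodule (hI : ∀ i ∈ I, β i = κ i) (𝒮 : Finset (Finset (Fin 3))) :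
    coeffSpace (𝒮.sup (poleSubmodule hI)) = 𝒮.sup (poleSpace κ I) := by
  induction 𝒮 using Finset.induction_on with
  | empty => rfl
  | insert S 𝒮 _ ih =>
    rw [Finset.sup_insert, Finset.sup_insert, ← ih]
    ext v
    exact (Submodule.mem_sup (p := poleSubmodule hI S)).trans
      (Submodule.mem_sup (p := poleSpace κ I S)
        (p' := coeffSpace (𝒮.sup (poleSubmodule hI)))).symm

/-- Properness is the separation of poles. For the covering property, an element of an intermediate
`P` outside the smaller sum is corrected to lie in the `S`-part, where it generates everything. -/
lemma sup_poleSubmodule_covBy (hI : ∀ i ∈ I, β i = κ i)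
    (hI' : ∀ i ∉ I, ∀ z : ℤ, β i - κ i + z ≠ 0) {S : Finset (Fin 3)} (hSI : S ⊆ I)
    (hS : S.card ≤ 2) {𝒮 : Finset (Finset (Fin 3))} (hlt : ∀ T, T ⊂ S → T ∈ 𝒮)
    (hnot : ∀ T ∈ 𝒮, ¬ S ⊆ T) :
    𝒮.sup (poleSubmodule hI) ⋖ (insert S 𝒮).sup (poleSubmodule hI) := by
  obtain ⟨k, hk⟩ : ∃ k, k ∉ S := by
    by_contra! h
    rw [Finset.eq_univ_of_forall h, Finset.card_univ, Fintype.card_fin] at hS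
    omega
  rw [Finset.sup_insert]
  refine ⟨lt_of_le_of_ne le_sup_right fun h => ?_, fun P hFP hP => ?_⟩
  · have hle : poleSubmodule hI S ≤ 𝒮.sup (poleSubmodule hI) := by
      rw [h]
      exact le_sup_left
    rw [poleSubmodule_le_iff, coeffSpace_sup_poleSubmodule] at hle
    refine shiftedMonomial_notMem_sup_poleSpace hSI hk 𝒮 hnot
      (hle (shiftedMonomial_mem_poleSpace fun t ht => ?_))
    by_contra htS
    simpa [htS] using (mem_negSet.mp ht).2
  · obtain ⟨v, hvP, hvF⟩ := Set.exists_of_ssubset hFP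
    obtain ⟨w, hw, f, hf, rfl⟩ := Submodule.mem_sup.mp (hP.le hvP)
    have hwP : w ∈ P := (Submodule.add_mem_iff_left P (hFP.le hf)).mp hvP
    have hwF : w ∉ 𝒮.sup (poleSubmodule hI) := fun h => hvF (Submodule.add_mem _ h hf)
    refine hP.not_ge (sup_le ?_ hFP.le)
    rw [poleSubmodule_le_iff]
    refine (isEulerStable_coeffSpace P).poleSpace_le
      (F := coeffSpace (𝒮.sup (poleSubmodule hI))) hI hI' hk (fun T hT => ?_) hw hwP hwF
    rw [← poleSubmodule_le_iff hI]
    exact Finset.le_sup (f := poleSubmodule hI) (hlt T hT)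

/-- Removing a member of largest cardinality keeps the family downward closed and lowers the length
by one. -/
lemma length_sup_poleSubmodule (hI : ∀ i ∈ I, β i = κ i)
    (hI' : ∀ i ∉ I, ∀ z : ℤ, β i - κ i + z ≠ 0) (n : ℕ) : ∀ 𝒮 : Finset (Finset (Fin 3)),
      𝒮.card = n → (∀ S ∈ 𝒮, S ⊆ I ∧ S.card ≤ 2 ∧ ∀ T ⊆ S, T ∈ 𝒮) →
      Module.length (WeylAlgebra 2) ↥(𝒮.sup (poleSubmodule hI)) = n := by
  induction n with
  | zero =>
    intro 𝒮 hn _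
    rw [Finset.card_eq_zero.mp hn, Finset.sup_empty]
    exact Module.length_bot
  | succ n ih =>
    intro 𝒮 hn h𝒮
    obtain ⟨S, hS, hmax⟩ := Finset.exists_max_image 𝒮 Finset.card
      (Finset.card_pos.mp (by omega))
    have hmax' : ∀ T ∈ 𝒮.erase S, ¬ S ⊆ T := fun T hT h =>
      Finset.ne_of_mem_erase hT
        (Finset.eq_of_subset_of_card_le h (hmax T (Finset.mem_of_mem_erase hT))).symm
    have hcov := sup_poleSubmodule_covBy hI hI' (h𝒮 S hS).1 (h𝒮 S hS).2.1 (𝒮 := 𝒮.erase S)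
      (fun T hT => Finset.mem_erase.mpr ⟨hT.ne, (h𝒮 S hS).2.2 T hT.le⟩) hmax'
    rw [Finset.insert_erase hS] at hcov
    rw [length_submodule_of_covBy hcov, ih (𝒮.erase S) (by rw [Finset.card_erase_of_mem hS]; omega)
      fun T hT => ?_]
    · rfl
    · have hT' := h𝒮 T (Finset.mem_of_mem_erase hT)
      refine ⟨hT'.1, hT'.2.1, fun U hU => Finset.mem_erase.mpr ⟨?_, hT'.2.2 U hU⟩⟩
      rintro rfl
      exact hmax' T hT hU

lemma sup_poleSubmodule_eq_top (hI : ∀ i ∈ I, β i = κ i) :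
    (I.powerset.filter fun S => S.card ≤ 2).sup (poleSubmodule hI) = ⊤ := by
  set F := (I.powerset.filter fun S => S.card ≤ 2).sup (poleSubmodule hI) with hF
  -- Only a monomial with three poles needs the relation, each term of which raises `∑ t, a t` by
  -- one. At `n = 0` this case is void, since three negative exponents give `-∑ t, a t ≥ 3`.
  have hmem (n : ℕ) : ∀ a : Fin 3 → ℤ, (-∑ t, a t) ≤ n → shiftedMonomial κ a ∈ coeffSpace F := by
    induction n with
    | zero | succ n ih =>
      intro a ha
      by_cases hk : ∃ k, k ∉ negSet I a
      · obtain ⟨k, hk⟩ := hk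
        refine Finset.le_sup (f := poleSubmodule hI) (b := negSet I a) ?_
          (shiftedMonomial_mem_poleSpace (Finset.Subset.refl _))
        have hcard := Finset.card_lt_univ_of_notMem hk
        rw [Fintype.card_fin] at hcard
        exact Finset.mem_filter.mpr
          ⟨Finset.mem_powerset.mpr (Finset.filter_subset _ _), by omega⟩
      · push Not at hk
        have hneg (t : Fin 3) : a t < 0 := (mem_negSet.mp (hk t)).2
        have h0 := hneg 0
        have h1 := hneg 1
        have h2 := hneg 2
        rw [Fin.sum_univ_three] at ha
        first
        | omega
        | rw [← sum_formSign_smul_shiftedMonomial]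
          refine Submodule.sum_mem _ fun k _ => Submodule.smul_mem _ _ (ih _ ?_)
          simp only [Pi.add_apply, Finset.sum_add_distrib, Finset.sum_pi_single',
            Finset.mem_univ, if_true]
          rw [Fin.sum_univ_three]
          push_cast at ha
          omega
  suffices h : ∀ v : LineRing, v ∈ coeffSpace F from eq_top_iff.mpr fun v _ => h v
  intro v
  obtain ⟨p, ⟨_, n, rfl⟩, hv⟩ := IsLocalization.exists_mk'_eq (Submonoid.powers (∏ k, lineForms k)) v
  have hunit : (formMonomial (fun _ => (n : ℤ)) : LineRing) =
      algebraMap (MvPolynomial (Fin 2) ℂ) LineRing ((∏ k, lineForms k) ^ n) := by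
    rw [formMonomial_natCast (fun _ => n), Finset.prod_pow]
  have hv' : v = algebraMap _ LineRing p *
      shiftedMonomial κ (κ + fun _ => -(n : ℤ)) := by
    rw [← hv, IsLocalization.mk'_eq_iff_eq_mul, mul_assoc]
    change _ = _ * (_ * algebraMap (MvPolynomial (Fin 2) ℂ) LineRing ((∏ k, lineForms k) ^ n))
    rw [← hunit, shiftedMonomial, ← Units.val_mul, ← formMonomial_add]
    have h0 : κ + (fun _ => -(n : ℤ)) - κ + (fun _ => (n : ℤ)) = 0 := by
      ext t
      simp
    rw [h0, formMonomial_zero, Units.val_one, mul_one]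
  rw [hv']
  exact algebraMap_mul_mem_coeffSpace F p _ (hmem _ _ (Int.self_le_toNat _))

/-- The length of `M_α^β` in terms of the set of integral exponents. -/
theorem length_twistedModule_lineForms (β : Fin 3 → ℂ) (I : Finset (Fin 3))
    (hI : ∀ i, i ∈ I ↔ ∃ k : ℤ, β i = k) :
    Module.length (WeylAlgebra 2) (TwistedModule lineForms β) =
      (I.powerset.filter fun S => S.card ≤ 2).card := by
  have hκ (i : Fin 3) : ∃ k : ℤ, i ∈ I → β i = k := by
    by_cases hi : i ∈ I
    · obtain ⟨k, hk⟩ := (hI i).mp hi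
      exact ⟨k, fun _ => hk⟩
    -- Off `I` any integer shift would do.
    · exact ⟨0, fun h => absurd h hi⟩
  choose κ hκ using hκ
  have hne (i : Fin 3) (hi : i ∉ I) (z : ℤ) : β i - κ i + z ≠ 0 := by
    intro h
    refine hi ((hI i).mpr ⟨κ i - z, ?_⟩)
    push_cast
    linear_combination h
  rw [← Module.length_top, ← sup_poleSubmodule_eq_top (κ := κ) (I := I) hκ]
  refine length_sup_poleSubmodule hκ hne _ _ rfl fun S hS => ?_
  rw [Finset.mem_filter, Finset.mem_powerset] at hS
  exact ⟨hS.1, hS.2, fun T hT => Finset.mem_filter.mpr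
    ⟨Finset.mem_powerset.mpr (hT.trans hS.1), (Finset.card_le_card hT).trans hS.2⟩⟩

/-- The count is `1 + m + m(m-1)/2` for `m = I.card ≤ 3`, so `Fin.ofNat 4` never wraps around. -/
lemma card_filter_powerset_card_le_two (I : Finset (Fin 3)) :
    (I.powerset.filter fun S => S.card ≤ 2).card = ![1, 2, 4, 7] (Fin.ofNat 4 I.card) := by
  decide +revert

end Length

end

theorem mainTheorem8 (β : Fin 3 → ℂ) :
    ({i : Fin 3 | ∃ k : ℤ, β i = k}.ncard = 0 →
      Module.length (WeylAlgebra 2) (TwistedModule lineForms β) = 1 ∧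
      IsSimpleModule (WeylAlgebra 2) (TwistedModule lineForms β)) ∧
    ({i : Fin 3 | ∃ k : ℤ, β i = k}.ncard = 1 →
      Module.length (WeylAlgebra 2) (TwistedModule lineForms β) = 2) ∧
    ({i : Fin 3 | ∃ k : ℤ, β i = k}.ncard = 2 →
      Module.length (WeylAlgebra 2) (TwistedModule lineForms β) = 4) ∧
    ({i : Fin 3 | ∃ k : ℤ, β i = k}.ncard = 3 →
      Module.length (WeylAlgebra 2) (TwistedModule lineForms β) = 7) := by
  classical
  have hlen := length_twistedModule_lineForms β (Finset.univ.filter fun i => ∃ k : ℤ, β i = k)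
    (by simp)
  rw [card_filter_powerset_card_le_two] at hlen
  have hcard : {i : Fin 3 | ∃ k : ℤ, β i = k}.ncard =
      (Finset.univ.filter fun i => ∃ k : ℤ, β i = k).card := by
    rw [← Set.ncard_coe_finset, Finset.coe_filter_univ]
  rw [← hcard] at hlen
  refine ⟨fun h => ?_, fun h => ?_, fun h => ?_, fun h => ?_⟩ <;> rw [h] at hlen
  · exact ⟨hlen, Module.length_eq_one_iff.mp hlen⟩
  all_goals exact hlen
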